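/- Let $d$ be a dimension, let $e_1,\dots,e_d$ be the standard basis of $\mathbb{Z}^d$, and call the sites $x\pm e_i$ the neighbours of $x\in\mathbb{Z}^d$. Let $\mathcal U=(\mathcal U_x)_{x\in\mathbb{Z}^d}$ be a family of independent Poisson clocks of rate one: the sets $\mathcal U_x\subset(0,\infty)$ of ringing times are independent Poisson point processes of unit intensity. The RSOS (restricted solid-on-solid) surface driven by $\mathcal U$ and started from the zero configuration is the integer-valued process $\mathrm{RSOS}(t,x)$, $t\ge 0$, $x\in\mathbb{Z}^d$, with the following properties: $\mathrm{RSOS}(0,x)=0$ for all $x$; the height over $x$ changes only at the times in $\mathcal U_x$; and at every $t\in\mathcal U_x$, $\mathrm{RSOS}(t,x)=\mathrm{RSOS}(t^-,x)+1$ if $|\mathrm{RSOS}(t^-,x)+1-\mathrm{RSOS}(t^-,y)|\le 1$ for every neighbour $y$ of $x$, and $\mathrm{RSOS}(t,x)=\mathrm{RSOS}(t^-,x)$ otherwise. Then, almost surely, there is exactly one such process, and for every $t\ge 0$ and $x\in\mathbb{Z}^d$ the height $\mathrm{RSOS}(t,x)$ is a square-integrable random variable with $$\operatorname{Var}\bigl(\mathrm{RSOS}(t,x)\bigr)\le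 t .$$ -/

import Mathlib

open MeasureTheory ProbabilityTheory Filter Topology Set
open scoped NNReal

/-- The sites of the lattice `ℤ^d`. -/
abbrev Site (d : ℕ) : Type := Fin d → ℤ

/-- `y` is one of the `2d` nearest neighbours `x ± e_i` of `x`. -/
def IsNeighbor {d : ℕ} (x y : Site d) : Prop :=
  ∃ i : Fin d, y = x + Pi.single i 1 ∨ y = x - Pi.single i 1

open Classical in
/-- The RSOS driving function: from the surface `g` just before a clock ring over `x`, the height
at `x` just after the ring. The height is raised by one if the raised height differs by at most one
from the heights at all neighbours, and otherwise it is left unchanged. -/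
noncomputable def rsosRule {d : ℕ} (g : Site d → ℤ) (x : Site d) : ℤ :=
  if ∀ y, IsNeighbor x y → |g x + 1 - g y| ≤ 1 then g x + 1 else g x

/-- `f` (with `f t x` the height at time `t` over the site `x`) is an RSOS surface with initial
configuration `H`, driven by clocks ringing over the site `x` at the times in `U x`. -/
structure IsRSOS {d : ℕ} (U : Site d → Set ℝ≥0) (H : Site d → ℤ) (f : ℝ≥0 → Site d → ℤ) :
    Prop where
  /-- The surface starts from `H`. -/
  init : ∀ x, f 0 x = H x
  /-- The height over `x` does not change while the clock over `x` does not ring. -/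
  stay : ∀ x s t, s ≤ t → Disjoint (U x) (Ioc s t) → f t x = f s x
  /-- When the clock over `x` rings at time `t`, the driving function is applied to the heights
  immediately before `t`, that is, to `f s` for all `s < t` close enough to `t`. (The driving
  function reads finitely many heights, which are constant for `s < t` close to `t` when the
  clocks ring at locally finitely many times.) -/
  ring : ∀ x, ∀ t ∈ U x, 0 < t → ∀ᶠ s in 𝓝[<] t, f t x = rsosRule (f s) x

/-- The number of points of the random set `T` in the interval `(p.1, p.2]`. -/
noncomputable def ringCount {Ω : Type*} (T : Ω → Set ℝ≥0) (p : ℝ≥0 × ℝ≥0) (ω : Ω) : ℕ∞ :=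
  (T ω ∩ Ioc p.1 p.2).encard

/-- `T` is the random set of ringing times of a Poisson clock of rate one, i.e. a Poisson point
process of unit intensity on `(0, ∞)`. -/
structure IsPoissonClock {Ω : Type*} [MeasurableSpace Ω] (T : Ω → Set ℝ≥0) (μ : Measure Ω) :
    Prop where
  /-- All ringing times are positive. -/
  pos : ∀ ω, T ω ⊆ Ioi 0
  /-- The number of rings in an interval is a random variable. -/
  measurable_count : ∀ p, Measurable (ringCount T p)
  /-- The number of rings in `(a, b]` has the Poisson distribution of mean `b - a`. -/
  law_count : ∀ a b : ℝ≥0, a ≤ b →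
    μ.map (ringCount T (a, b)) = (poissonMeasure (b - a)).map (Nat.cast : ℕ → ℕ∞)
  /-- The numbers of rings in successive disjoint intervals are independent. -/
  indep_count : ∀ (n : ℕ) (s : Fin (n + 1) → ℝ≥0), Monotone s →
    iIndepFun (fun (i : Fin n) => ringCount T (s i.castSucc, s i.succ)) μ

/-- `U` is a family of independent Poisson clocks of rate one, one over each site of `ℤ^d`. -/
structure ArePoissonClocks {Ω : Type*} [MeasurableSpace Ω] {d : ℕ} (U : Site d → Ω → Set ℝ≥0)
    (μ : Measure Ω) : Prop where
  /-- Each `U x` is a Poisson clock of rate one. -/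
  clock : ∀ x, IsPoissonClock (U x) μ
  /-- The clocks over different sites are independent, each clock being represented by all its
  numbers of rings in intervals. -/
  indep : iIndepFun (fun x (ω : Ω) (p : ℝ≥0 × ℝ≥0) => ringCount (U x) p ω) μ

/-! ### Discrete surfaces -/

/-! Cut `[0, t]` into `n + 1` slots and update simultaneously, once per slot, all sites whose clock
rings in it. The discretised height is a function of finitely many independent bits, each `true`
with probability `p = 1 - exp (-t / (n + 1))`.

By Efron–Stein (`variance_comp_le`) its variance is at most `p` times the expected sum, over the
silent bits, of the squared change caused by an additional ring. On Lipschitz surfaces the RSOS rule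
is "neighbourhood minimum plus one", which is monotone and commutes with minima. So if two silent
clocks of the same round are made to ring separately, the original surface is the minimum of the two
perturbed ones (`heights_eq_min`). Hence at most one silent clock per round can raise the final
height, and it does so by one. The sum is at most the number of rounds, and the variance is at most
`(n + 1) * p ≤ t`.

Almost surely there is no infinite chain of dependencies backwards in time: the expected number of
chains of `m` rings is at most `((2 * d + 1) * t) ^ m / m!`. Recursion along dependencies then
constructs the surface, and induction along them shows that the discretised heights are eventually
equal to it. This gives uniqueness, and Fatou's lemma carries the variance bound to the limit. -/

open Classical in
/-- The site `x` together with its neighbours. -/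
noncomputable def closedNbhd {d : ℕ} (x : Site d) : Finset (Site d) :=
  insert x (Finset.univ.image (fun i : Fin d => x + Pi.single i 1) ∪
    Finset.univ.image (fun i : Fin d => x - Pi.single i 1))

theorem mem_closedNbhd {d : ℕ} {x y : Site d} : y ∈ closedNbhd x ↔ y = x ∨ IsNeighbor x y := by
  simp only [closedNbhd, Finset.mem_insert, Finset.mem_union, Finset.mem_image, Finset.mem_univ,
    true_and, IsNeighbor, exists_or, eq_comm]

theorem self_mem_closedNbhd {d : ℕ} (x : Site d) : x ∈ closedNbhd x :=
  mem_closedNbhd.2 (Or.inl rfl)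

theorem closedNbhd_nonempty {d : ℕ} (x : Site d) : (closedNbhd x).Nonempty :=
  ⟨x, self_mem_closedNbhd x⟩

theorem IsNeighbor.symm {d : ℕ} {x y : Site d} (h : IsNeighbor x y) : IsNeighbor y x := by
  obtain ⟨i, rfl | rfl⟩ := h
  · exact ⟨i, Or.inr (by simp)⟩
  · exact ⟨i, Or.inl (by simp)⟩

theorem card_closedNbhd_le {d : ℕ} (x : Site d) : (closedNbhd x).card ≤ 2 * d + 1 := by
  classical
  refine (Finset.card_insert_le _ _).trans ?_
  have h1 := Finset.card_union_le (Finset.univ.image (fun i : Fin d => x + Pi.single i 1))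
    (Finset.univ.image (fun i : Fin d => x - Pi.single i 1))
  have h2 := Finset.card_image_le (s := (Finset.univ : Finset (Fin d)))
    (f := fun i : Fin d => x + Pi.single i 1)
  have h3 := Finset.card_image_le (s := (Finset.univ : Finset (Fin d)))
    (f := fun i : Fin d => x - Pi.single i 1)
  simp only [Finset.card_univ, Fintype.card_fin] at h2 h3
  convert! (by omega : (Finset.univ.image (fun i : Fin d => x + Pi.single i 1) ∪
    Finset.univ.image (fun i : Fin d => x - Pi.single i 1)).card + 1 ≤ 2 * d + 1)

/-- One more than the smallest height over `x` and its neighbours. -/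
noncomputable def minRule {d : ℕ} (g : Site d → ℤ) (x : Site d) : ℤ :=
  (closedNbhd x).inf' (closedNbhd_nonempty x) g + 1

theorem lt_minRule_iff {d : ℕ} {g : Site d → ℤ} {x : Site d} {a : ℤ} :
    a < minRule g x ↔ ∀ y ∈ closedNbhd x, a ≤ g y := by
  rw [minRule, Int.lt_add_one_iff, Finset.le_inf'_iff]

theorem minRule_le_add_one {d : ℕ} (g : Site d → ℤ) {x y : Site d} (hy : y ∈ closedNbhd x) :
    minRule g x ≤ g y + 1 := by
  have := Finset.inf'_le g hy
  rw [minRule]; omega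

theorem exists_minRule_eq {d : ℕ} (g : Site d → ℤ) (x : Site d) :
    ∃ y ∈ closedNbhd x, minRule g x = g y + 1 := by
  obtain ⟨y, hy, h⟩ := Finset.exists_mem_eq_inf' (closedNbhd_nonempty x) g
  exact ⟨y, hy, by rw [minRule, h]⟩

theorem minRule_mono {d : ℕ} {g h : Site d → ℤ} (hgh : ∀ x, g x ≤ h x) (x : Site d) :
    minRule g x ≤ minRule h x := by
  obtain ⟨y, hy, e⟩ := exists_minRule_eq h x
  have := minRule_le_add_one g hy
  have := hgh y
  omega

theorem minRule_le_add_one_of_le {d : ℕ} {g h : Site d → ℤ} (hgh : ∀ x, g x ≤ h x + 1)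
    (x : Site d) : minRule g x ≤ minRule h x + 1 := by
  obtain ⟨y, hy, e⟩ := exists_minRule_eq h x
  have := minRule_le_add_one g hy
  have := hgh y
  omega

theorem minRule_min {d : ℕ} {f g h : Site d → ℤ} (hf : ∀ x, f x = min (g x) (h x))
    (x : Site d) : minRule f x = min (minRule g x) (minRule h x) := by
  apply le_antisymm
  · exact le_min (minRule_mono (fun y => by rw [hf]; exact min_le_left _ _) x)
      (minRule_mono (fun y => by rw [hf]; exact min_le_right _ _) x)
  · obtain ⟨y, hy, e⟩ := exists_minRule_eq f x
    have h1 := minRule_le_add_one g hy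
    have h2 := minRule_le_add_one h hy
    have := hf y
    omega

/-- Heights over neighbouring sites differ by at most one. -/
def IsLipschitz {d : ℕ} (g : Site d → ℤ) : Prop :=
  ∀ x, ∀ y ∈ closedNbhd x, g x ≤ g y + 1

theorem IsLipschitz.le_minRule {d : ℕ} {g : Site d → ℤ} (hg : IsLipschitz g) (x : Site d) :
    g x ≤ minRule g x := by
  obtain ⟨y, hy, e⟩ := exists_minRule_eq g x
  rw [e]
  exact hg x y hy

/-- Of the two inequalities in `|g x + 1 - g y| ≤ 1`, the Lipschitz property supplies `g y ≤ g x +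
2`; what remains, `g x ≤ g y` for every neighbour, says that the minimum is attained at `x`. -/
theorem IsLipschitz.minRule_eq {d : ℕ} {g : Site d → ℤ} (hg : IsLipschitz g) (x : Site d) :
    minRule g x = rsosRule g x := by
  have h1 := hg.le_minRule x
  have h2 := minRule_le_add_one g (self_mem_closedNbhd x)
  rw [rsosRule]
  split_ifs with h
  · have : g x < minRule g x := by
      refine lt_minRule_iff.2 fun y hy => ?_
      rcases mem_closedNbhd.1 hy with rfl | hy
      · exact le_rfl
      · have := abs_le.1 (h y hy)
        omega
    omega
  · by_contra hne
    have h3 : g x < minRule g x := by omega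
    refine h fun y hy => ?_
    have h4 := lt_minRule_iff.1 h3 y (mem_closedNbhd.2 (Or.inr hy))
    have h5 := hg y x (mem_closedNbhd.2 (Or.inr hy.symm))
    rw [abs_le]
    omega

theorem rsosRule_congr {d : ℕ} {g h : Site d → ℤ} {x : Site d}
    (hgh : ∀ y ∈ closedNbhd x, g y = h y) : rsosRule g x = rsosRule h x := by
  have hx := hgh x (self_mem_closedNbhd x)
  have : (∀ y, IsNeighbor x y → |g x + 1 - g y| ≤ 1) ↔
      ∀ y, IsNeighbor x y → |h x + 1 - h y| ≤ 1 := by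
    refine forall₂_congr fun y hy => ?_
    rw [hx, hgh y (mem_closedNbhd.2 (Or.inr hy))]
  rw [rsosRule, rsosRule]
  by_cases h' : ∀ y, IsNeighbor x y → |h x + 1 - h y| ≤ 1
  · rw [if_pos h', if_pos (this.2 h'), hx]
  · rw [if_neg h', if_neg (fun hg => h' (this.1 hg)), hx]

theorem minRule_congr {d : ℕ} {g h : Site d → ℤ} {x : Site d}
    (hgh : ∀ y ∈ closedNbhd x, g y = h y) : minRule g x = minRule h x := by
  rw [minRule, minRule, Finset.inf'_congr _ rfl hgh]

/-- The heights after `k` rounds, where in round `k` the heights over all sites `x` with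
`b (x, k) = true` are updated simultaneously. -/
noncomputable def heights {d : ℕ} (b : Site d × ℕ → Bool) : ℕ → Site d → ℤ
  | 0, _ => 0
  | k + 1, x => if b (x, k) then minRule (heights b k) x else heights b k x

/-- Simultaneous updates are harmless: the new height over `x` is at most the old height over `y`
plus one, and heights never decrease. -/
theorem isLipschitz_heights {d : ℕ} (b : Site d × ℕ → Bool) (k : ℕ) :
    IsLipschitz (heights b k) := by
  induction k with
  | zero => intro x y _; simp [heights]
  | succ k ih =>
    intro x y hy
    have h1 := ih.le_minRule x
    have h2 := ih.le_minRule y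
    have h3 := minRule_le_add_one (heights b k) hy
    have h4 := ih x y hy
    simp only [heights]
    split_ifs <;> omega

theorem heights_succ_of_true {d : ℕ} {b : Site d × ℕ → Bool} {k : ℕ} {x : Site d}
    (h : b (x, k) = true) : heights b (k + 1) x = rsosRule (heights b k) x := by
  rw [heights, if_pos h, (isLipschitz_heights b k).minRule_eq]

theorem heights_eq_of_forall_false {d : ℕ} {b : Site d × ℕ → Bool} {i j : ℕ} {x : Site d}
    (hij : i ≤ j) (h : ∀ k, i ≤ k → k < j → b (x, k) = false) :
    heights b j x = heights b i x := by
  induction j, hij using Nat.le_induction with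
  | base => rfl
  | succ j hij ih =>
    rw [heights, h j hij (by omega), if_neg (by simp)]
    exact ih fun k hk hkj => h k hk (by omega)

theorem heights_nonneg {d : ℕ} (b : Site d × ℕ → Bool) (k : ℕ) (x : Site d) :
    0 ≤ heights b k x := by
  induction k with
  | zero => simp [heights]
  | succ k ih =>
    have := (isLipschitz_heights b k).le_minRule x
    simp only [heights]
    split_ifs <;> omega

theorem heights_le_sum {d : ℕ} (b : Site d × ℕ → Bool) (k : ℕ) (x : Site d) :
    heights b k x ≤ ∑ i ∈ Finset.range k, if b (x, i) then 1 else 0 := by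
  induction k with
  | zero => simp [heights]
  | succ k ih =>
    have := minRule_le_add_one (heights b k) (self_mem_closedNbhd x)
    rw [Finset.sum_range_succ]
    simp only [heights]
    split_ifs <;> omega

theorem exists_dependsOn_heights {d : ℕ} (k : ℕ) (x : Site d) :
    ∃ L : Finset (Site d × ℕ), (∀ i ∈ L, i.2 < k) ∧
      DependsOn (fun b : Site d × ℕ → Bool => heights b k x) (L : Set (Site d × ℕ)) := by
  classical
  induction k generalizing x with
  | zero => exact ⟨∅, by simp, fun _ _ _ => by simp [heights]⟩
  | succ k ih =>
    choose L hL hd using ih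
    refine ⟨insert (x, k) ((closedNbhd x).biUnion L), ?_, fun b b' h => ?_⟩
    · intro i hi
      rcases Finset.mem_insert.1 hi with rfl | hi
      · exact Nat.lt_succ_self _
      · obtain ⟨y, _, hy⟩ := Finset.mem_biUnion.1 hi
        exact (hL y i hy).trans (Nat.lt_succ_self _)
    · have e : ∀ y ∈ closedNbhd x, heights b k y = heights b' k y := fun y hy =>
        hd y fun i hi => h i (Finset.mem_coe.2 (Finset.mem_insert_of_mem
          (Finset.mem_biUnion.2 ⟨y, hy, hi⟩)))
      have e' := h (x, k) (Finset.mem_coe.2 (Finset.mem_insert_self _ _))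
      simp only [heights]
      rw [e', e x (self_mem_closedNbhd x), minRule_congr e]

theorem heights_update_of_le {d : ℕ} (b : Site d × ℕ → Bool) (y : Site d) (v : Bool) {j k : ℕ}
    (hkj : k ≤ j) (x : Site d) : heights (Function.update b (y, j) v) k x = heights b k x := by
  induction k generalizing x with
  | zero => rfl
  | succ k ih =>
    have e : heights (Function.update b (y, j) v) k = heights b k :=
      funext fun x => ih (by omega) x
    simp only [heights]
    rw [e, Function.update_of_ne (by simp only [ne_eq, Prod.mk.injEq, not_and]; omega)]

/-- The additional ring raises one height by at most one; afterwards the gap stays in `{0, 1}`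
because the rule is monotone and commutes with adding one. -/
theorem heights_le_update {d : ℕ} {b : Site d × ℕ → Bool} {y : Site d} {j : ℕ}
    (hb : b (y, j) = false) (k : ℕ) (x : Site d) :
    heights b k x ≤ heights (Function.update b (y, j) true) k x ∧
      heights (Function.update b (y, j) true) k x ≤ heights b k x + 1 := by
  induction k generalizing x with
  | zero => simp [heights]
  | succ k ih =>
    have h1 := minRule_mono (fun x => (ih x).1) x
    have h2 := minRule_le_add_one_of_le (fun x => (ih x).2) x
    have h3 := ih x
    by_cases hx : (x, k) = (y, j)
    · obtain ⟨rfl, rfl⟩ := Prod.mk.inj hx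
      have e : heights (Function.update b (x, k) true) k = heights b k :=
        funext fun z => heights_update_of_le b x true le_rfl z
      have h4 := (isLipschitz_heights b k).le_minRule x
      have h5 := minRule_le_add_one (heights b k) (self_mem_closedNbhd x)
      simp only [heights, Function.update_self, hb, e]
      simpa using ⟨h4, h5⟩
    · simp only [heights]
      rw [Function.update_of_ne hx]
      split_ifs <;> omega

/-- In round `j` the additional rings act on different sites, so at each site one of the perturbed
surfaces still agrees with the original; later rounds commute with minima. It matters that both
rings belong to the same round. -/
theorem heights_eq_min {d : ℕ} {b : Site d × ℕ → Bool} {y z : Site d} {j : ℕ} (hyz : y ≠ z)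
    (hy : b (y, j) = false) (hz : b (z, j) = false) (k : ℕ) (x : Site d) :
    heights b k x = min (heights (Function.update b (y, j) true) k x)
      (heights (Function.update b (z, j) true) k x) := by
  induction k generalizing x with
  | zero => simp [heights]
  | succ k ih =>
    have h1 := minRule_min ih x
    have h2 := ih x
    have h3 := heights_le_update hy (k + 1) x
    have h4 := heights_le_update hz (k + 1) x
    by_cases hxy : (x, k) = (y, j)
    · have hxz : (x, k) ≠ (z, j) := fun h => hyz (Prod.mk.inj (hxy.symm.trans h)).1
      rw [heights_update_of_le b z true (Prod.mk.inj hxy).2.le] at h2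
      have e : heights (Function.update b (z, j) true) (k + 1) x = heights b (k + 1) x := by
        simp only [heights]
        rw [Function.update_of_ne hxz, hxy, hy, if_neg (by simp), if_neg (by simp),
          heights_update_of_le b z true (Prod.mk.inj hxy).2.le]
      omega
    · by_cases hxz : (x, k) = (z, j)
      · have e : heights (Function.update b (y, j) true) (k + 1) x = heights b (k + 1) x := by
          simp only [heights]
          rw [Function.update_of_ne hxy, hxz, hz, if_neg (by simp), if_neg (by simp),
            heights_update_of_le b y true (Prod.mk.inj hxz).2.le]
        omega
      · simp only [heights]
        rw [Function.update_of_ne hxy, Function.update_of_ne hxz]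
        split_ifs <;> omega

/-- Among the clocks that are silent in a given round, at most one has the property that an
additional ring changes the final height over `x`, and then it changes it by one. -/
theorem sum_sq_heights_update_sub_le {d : ℕ} (b : Site d × ℕ → Bool) (k : ℕ) (x : Site d)
    (L : Finset (Site d × ℕ)) (hL : ∀ i ∈ L, i.2 < k) :
    ∑ i ∈ L, (if b i = false then
      ((heights (Function.update b i true) k x : ℝ) - heights b k x) ^ 2 else 0) ≤ k := by
  classical
  rw [← Finset.sum_fiberwise_of_maps_to (g := Prod.snd) (t := Finset.range k)
    (fun i hi => Finset.mem_range.2 (hL i hi))]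
  refine (Finset.sum_le_card_nsmul _ _ 1 fun j _ => ?_).trans (by simp)
  set a : Site d × ℕ → ℝ := fun i => if b i = false then
      ((heights (Function.update b i true) k x : ℝ) - heights b k x) ^ 2 else 0 with ha
  have ha1 : ∀ i, a i ≤ 1 := by
    rintro ⟨y, j⟩
    simp only [ha]
    split_ifs with hb
    · have h := heights_le_update hb k x
      obtain h | h : heights (Function.update b (y, j) true) k x = heights b k x ∨
        heights (Function.update b (y, j) true) k x = heights b k x + 1 := by omega
      · simp [h]
      · simp [h]
    · exact zero_le_one
  by_cases hex : ∃ i ∈ L.filter (fun i => i.2 = j), a i ≠ 0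
  · obtain ⟨i, hi, hi0⟩ := hex
    rw [Finset.sum_eq_single_of_mem i hi]
    · exact ha1 i
    · rintro ⟨z, j'⟩ hi' hne
      obtain ⟨y, j''⟩ := i
      obtain rfl : j' = j := (Finset.mem_filter.1 hi').2
      obtain rfl : j'' = j' := (Finset.mem_filter.1 hi).2
      have hyz : y ≠ z := fun h => hne (by rw [h])
      simp only [ha, ne_eq, ite_eq_right_iff, Classical.not_imp] at hi0 ⊢
      intro hz
      obtain ⟨hy, hi0⟩ := hi0
      -- The ring over `y` strictly raises the height, so the minimum is attained by the surface
      -- with the ring over `z`, which is therefore unchanged.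
      have h1 := heights_eq_min hyz hy hz k x
      have h2 := (heights_le_update hz k x).1
      have h3 : heights (Function.update b (y, j'') true) k x ≠ heights b k x :=
        fun h => hi0 (by simp [h])
      have h4 : heights (Function.update b (z, j'') true) k x = heights b k x := by omega
      simp [h4]
  · push Not at hex
    rw [Finset.sum_eq_zero hex]
    exact zero_le_one

/-- The number of chains of `m` rings in decreasing rounds before round `k`, the first one over
`x`, and each of the others over a site equal or neighbouring to the site of its predecessor. -/
noncomputable def chainCount {d : ℕ} (b : Site d × ℕ → Bool) : ℕ → ℕ → Site d → ℕ
  | _, 0, _ => 1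
  | 0, _ + 1, _ => 0
  | k + 1, m + 1, x => chainCount b k (m + 1) x +
      if b (x, k) then ∑ y ∈ closedNbhd x, chainCount b k m y else 0

theorem chainCount_mono {d : ℕ} (b : Site d × ℕ → Bool) {j k : ℕ} (hjk : j ≤ k) (m : ℕ)
    (x : Site d) : chainCount b j m x ≤ chainCount b k m x := by
  induction k, hjk using Nat.le_induction with
  | base => rfl
  | succ k _ ih =>
    cases m with
    | zero => simp [chainCount]
    | succ m =>
      rw [chainCount.eq_3]
      exact ih.trans (Nat.le_add_right _ _)

theorem exists_dependsOn_chainCount {d : ℕ} (k m : ℕ) (x : Site d) :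
    ∃ L : Finset (Site d × ℕ), (∀ i ∈ L, i.2 < k) ∧
      DependsOn (fun b : Site d × ℕ → Bool => chainCount b k m x) (L : Set (Site d × ℕ)) := by
  classical
  induction k generalizing x m with
  | zero =>
    refine ⟨∅, by simp, fun _ _ _ => ?_⟩
    cases m <;> simp [chainCount]
  | succ k ih =>
    choose L hL hd using ih
    cases m with
    | zero => exact ⟨∅, by simp, fun _ _ _ => by simp [chainCount]⟩
    | succ m =>
    refine ⟨insert (x, k) (L (m + 1) x ∪ (closedNbhd x).biUnion (L m)), ?_, fun b b' h => ?_⟩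
    · intro i hi
      rcases Finset.mem_insert.1 hi with rfl | hi
      · exact Nat.lt_succ_self _
      rcases Finset.mem_union.1 hi with hi | hi
      · exact (hL _ _ i hi).trans (Nat.lt_succ_self _)
      · obtain ⟨y, _, hy⟩ := Finset.mem_biUnion.1 hi
        exact (hL _ y i hy).trans (Nat.lt_succ_self _)
    · have e : ∀ y ∈ closedNbhd x, chainCount b k m y = chainCount b' k m y := fun y hy =>
        hd m y fun i hi => h i (Finset.mem_coe.2 (Finset.mem_insert_of_mem
          (Finset.mem_union_right _ (Finset.mem_biUnion.2 ⟨y, hy, hi⟩))))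
      have e' := h (x, k) (Finset.mem_coe.2 (Finset.mem_insert_self _ _))
      have e'' : chainCount b k (m + 1) x = chainCount b' k (m + 1) x :=
        hd (m + 1) x fun i hi => h i (Finset.mem_coe.2 (Finset.mem_insert_of_mem
          (Finset.mem_union_left _ hi)))
      simp only [chainCount.eq_3]
      rw [e', e'', Finset.sum_congr rfl e]

/-! ### Surfaces driven by a fixed realisation of the clocks -/

/-- The ring of the clock over `p.2` at time `q.1`, before time `p.1`, makes the height over `p.2`
immediately before time `p.1` depend on the height over `q.2` immediately before time `q.1`. -/
def Precedes {d : ℕ} (U : Site d → Set ℝ≥0) (q p : ℝ≥0 × Site d) : Prop :=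
  q.1 < p.1 ∧ q.1 ∈ U p.2 ∧ q.2 ∈ closedNbhd p.2

/-- A realisation of the clocks for which the surface is well defined. -/
structure IsGoodClocks {d : ℕ} (U : Site d → Set ℝ≥0) : Prop where
  /-- All ringing times are positive. -/
  pos : ∀ x, U x ⊆ Ioi 0
  /-- Each clock rings at locally finitely many times. -/
  finite : ∀ x t, (U x ∩ Iic t).Finite
  /-- There is no infinite chain of dependencies. -/
  wf : WellFounded (Precedes U)

open Classical in
/-- The indicators of the events that the clock over `x` rings in the time slot
`(k * δ, (k + 1) * δ]`. -/
noncomputable def gridBits {d : ℕ} (U : Site d → Set ℝ≥0) (δ : ℝ≥0) (i : Site d × ℕ) : Bool :=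
  decide (U i.1 ∩ Ioc (i.2 * δ) ((i.2 + 1) * δ)).Nonempty

theorem exists_slot {δ τ : ℝ≥0} (hδ : 0 < δ) (hτ : 0 < τ) :
    ∃ i : ℕ, i * δ < τ ∧ τ ≤ (i + 1) * δ := by
  obtain ⟨n, hn⟩ := Nat.exists_eq_succ_of_ne_zero (Nat.ceil_pos.2 (div_pos hτ hδ)).ne'
  refine ⟨n, ?_, ?_⟩
  · rw [← lt_div_iff₀ hδ, ← Nat.lt_ceil, hn]
    exact Nat.lt_succ_self n
  · rw [← div_le_iff₀ hδ]
    have := Nat.le_ceil (τ / δ)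
    rw [hn] at this
    exact_mod_cast this

theorem gridBits_eq_true {d : ℕ} {U : Site d → Set ℝ≥0} {δ τ : ℝ≥0} {x : Site d} {i : ℕ}
    (hτ : τ ∈ U x) (h1 : i * δ < τ) (h2 : τ ≤ (i + 1) * δ) : gridBits U δ (x, i) = true := by
  simp only [gridBits, decide_eq_true_eq]
  exact ⟨τ, hτ, h1, h2⟩

theorem heights_gridBits_eq {d : ℕ} {U : Site d → Set ℝ≥0} {δ : ℝ≥0} {x : Site d} {i j : ℕ}
    (hij : i ≤ j) (h : ∀ τ ∈ U x, i * δ < τ → ¬ τ ≤ j * δ) :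
    heights (gridBits U δ) j x = heights (gridBits U δ) i x := by
  refine heights_eq_of_forall_false hij fun k hik hkj => ?_
  simp only [gridBits, decide_eq_false_iff_not]
  rintro ⟨τ, hτ, h1, h2⟩
  refine h τ hτ (lt_of_le_of_lt ?_ h1) (h2.trans ?_)
  · gcongr
  · gcongr
    exact_mod_cast hkj

theorem Set.Finite.exists_isGreatest {S : Set ℝ≥0} (hS : S.Finite) (h : S.Nonempty) :
    ∃ τ, IsGreatest S τ := by
  obtain ⟨τ, hτ, hmax⟩ := hS.exists_maximal h
  exact ⟨τ, hτ, fun s hs => not_lt.1 fun hlt => hlt.not_ge (hmax hs hlt.le)⟩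

/-! ### Convergence of the discretisations, uniqueness and existence -/

section Convergence

variable {d : ℕ} {U : Site d → Set ℝ≥0} {f : ℝ≥0 → Site d → ℤ} {δ : ℕ → ℝ≥0}

theorem IsRSOS.eventually_eq_heights_succ (hU : IsGoodClocks U) (hf : IsRSOS U 0 f)
    {τ : ℝ≥0} {x : Site d} (hτ : τ ∈ U x)
    (h : ∀ y ∈ closedNbhd x, ∀ᶠ n in atTop, ∀ i : ℕ, i * δ n < τ → τ ≤ (i + 1) * δ n →
      ∀ᶠ s in 𝓝[<] τ, f s y = heights (gridBits U (δ n)) i y) :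
    ∀ᶠ n in atTop, ∀ i : ℕ, i * δ n < τ → τ ≤ (i + 1) * δ n →
      f τ x = heights (gridBits U (δ n)) (i + 1) x := by
  have hτ0 : 0 < τ := hU.pos x hτ
  have : (𝓝[<] τ).NeBot := nhdsLT_neBot_of_exists_lt ⟨0, hτ0⟩
  filter_upwards [(Finset.eventually_all _).2 h] with n hn i h1 h2
  have h3 := (Finset.eventually_all _).2 fun y hy => hn y hy i h1 h2
  obtain ⟨s, hs, hs'⟩ := (h3.and (hf.ring x τ hτ hτ0)).exists
  rw [heights_succ_of_true (gridBits_eq_true hτ h1 h2), hs']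
  exact rsosRule_congr hs

/-- Well-founded induction along `Precedes`: the height just before `t` was set by the last earlier
ring `τ`, which read the heights just before `τ` near `x`. Once `δ n < t - τ`, this ring falls in a
strictly earlier slot than `t`. -/
theorem IsRSOS.eventually_eq_heights_left (hU : IsGoodClocks U) (hf : IsRSOS U 0 f)
    (hδ : ∀ n, 0 < δ n) (hδ0 : Tendsto δ atTop (𝓝 0)) (p : ℝ≥0 × Site d) :
    ∀ᶠ n in atTop, ∀ j : ℕ, j * δ n < p.1 → p.1 ≤ (j + 1) * δ n →
      ∀ᶠ s in 𝓝[<] p.1, f s p.2 = heights (gridBits U (δ n)) j p.2 := by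
  induction p using hU.wf.induction with
  | h p ih =>
  obtain ⟨t, x⟩ := p
  dsimp only at ih ⊢
  have hfin : (U x ∩ Iio t).Finite :=
    (hU.finite x t).subset (inter_subset_inter_right _ Iio_subset_Iic_self)
  rcases (U x ∩ Iio t).eq_empty_or_nonempty with he | hne
  · refine Eventually.of_forall fun n j hj _ => ?_
    rw [heights_gridBits_eq (Nat.zero_le j) fun τ hτ _ hτj =>
      (he.subset ⟨hτ, hτj.trans_lt hj⟩ : τ ∈ (∅ : Set ℝ≥0))]
    filter_upwards [self_mem_nhdsWithin] with s hs
    rw [hf.stay x 0 s zero_le (disjoint_left.2 fun τ hτ hτs =>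
      (he.subset ⟨hτ, hτs.2.trans_lt hs⟩ : τ ∈ (∅ : Set ℝ≥0))), hf.init]
    rfl
  · obtain ⟨τ, ⟨hτ, hτt⟩, hmax⟩ := hfin.exists_isGreatest hne
    have hstep := hf.eventually_eq_heights_succ hU hτ fun y hy => ih (τ, y) ⟨hτt, hτ, hy⟩
    have hsmall : ∀ᶠ n in atTop, δ n < t - τ :=
      hδ0.eventually (gt_mem_nhds (tsub_pos_of_lt hτt))
    filter_upwards [hstep, hsmall] with n hn hnδ j hj hj'
    obtain ⟨i, hi, hi'⟩ := exists_slot (hδ n) (hU.pos x hτ)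
    have hij : i < j := by
      have h1 : δ n + τ < t := lt_tsub_iff_right.1 hnδ
      have h2 : (i : ℝ≥0) * δ n + δ n < j * δ n + δ n := by
        calc (i : ℝ≥0) * δ n + δ n < τ + δ n := by gcongr
          _ = δ n + τ := add_comm _ _
          _ < t := h1
          _ ≤ j * δ n + δ n := by rwa [add_mul, one_mul] at hj'
      exact_mod_cast lt_of_mul_lt_mul_right (lt_of_add_lt_add_right h2) zero_le
    rw [heights_gridBits_eq (i := i + 1) hij fun σ hσ h1 h2 =>
      (hmax ⟨hσ, h2.trans_lt hj⟩).not_gt (hi'.trans_lt (by exact_mod_cast h1)),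
      ← hn i hi hi']
    filter_upwards [Ioo_mem_nhdsLT hτt] with s hs
    exact hf.stay x τ s hs.1.le (disjoint_left.2 fun σ hσ hσs =>
      (hmax ⟨hσ, hσs.2.trans_lt hs.2⟩).not_gt hσs.1)

/-- Every surface is the limit of its discretisations. -/
theorem IsRSOS.eventually_eq_heights (hU : IsGoodClocks U) (hf : IsRSOS U 0 f)
    (hδ : ∀ n, 0 < δ n) (hδ0 : Tendsto δ atTop (𝓝 0)) {t : ℝ≥0} {k : ℕ → ℕ}
    (hk : ∀ n, k n * δ n = t) (x : Site d) :
    ∀ᶠ n in atTop, f t x = heights (gridBits U (δ n)) (k n) x := by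
  rcases (U x ∩ Iic t).eq_empty_or_nonempty with he | hne
  · refine Eventually.of_forall fun n => ?_
    rw [heights_gridBits_eq (Nat.zero_le _) fun τ hτ _ hτj =>
      (he.subset ⟨hτ, hτj.trans_eq (hk n)⟩ : τ ∈ (∅ : Set ℝ≥0)),
      hf.stay x 0 t zero_le (disjoint_left.2 fun τ hτ hτs =>
      (he.subset ⟨hτ, hτs.2⟩ : τ ∈ (∅ : Set ℝ≥0))), hf.init]
    rfl
  · obtain ⟨τ, ⟨hτ, hτt⟩, hmax⟩ := (hU.finite x t).exists_isGreatest hne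
    have hstep := hf.eventually_eq_heights_succ hU hτ fun y _ =>
      hf.eventually_eq_heights_left hU hδ hδ0 (τ, y)
    filter_upwards [hstep] with n hn
    obtain ⟨i, hi, hi'⟩ := exists_slot (hδ n) (hU.pos x hτ)
    have hij : i < k n := by
      have h2 : (i : ℝ≥0) * δ n < k n * δ n := hi.trans_le (hτt.trans_eq (hk n).symm)
      exact_mod_cast lt_of_mul_lt_mul_right h2 zero_le
    rw [heights_gridBits_eq (i := i + 1) hij fun σ hσ h1 h2 =>
      (hmax ⟨hσ, h2.trans_eq (hk n)⟩).not_gt (hi'.trans_lt (by exact_mod_cast h1)),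
      ← hn i hi hi']
    exact hf.stay x τ t hτt (disjoint_left.2 fun σ hσ hσs => (hmax ⟨hσ, hσs.2⟩).not_gt hσs.1)

end Convergence

theorem tendsto_div_natCast_add_one (t : ℝ≥0) :
    Tendsto (fun n : ℕ => t / ((n + 1 : ℕ) : ℝ≥0)) atTop (𝓝 0) := by
  rw [← NNReal.tendsto_coe]
  simpa [Function.comp_def] using
    (tendsto_const_div_atTop_nhds_zero_nat (t : ℝ)).comp (tendsto_add_atTop_nat 1)

theorem natCast_add_one_mul_div (t : ℝ≥0) (n : ℕ) :
    ((n + 1 : ℕ) : ℝ≥0) * (t / ((n + 1 : ℕ) : ℝ≥0)) = t :=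
  mul_div_cancel₀ t (by exact_mod_cast Nat.succ_ne_zero n)

theorem IsRSOS.eventually_eq_heights_div {d : ℕ} {U : Site d → Set ℝ≥0} {f : ℝ≥0 → Site d → ℤ}
    (hU : IsGoodClocks U) (hf : IsRSOS U 0 f) {t : ℝ≥0} (ht : 0 < t) (x : Site d) :
    ∀ᶠ n : ℕ in atTop, f t x = heights (gridBits U (t / ((n + 1 : ℕ) : ℝ≥0))) (n + 1) x :=
  hf.eventually_eq_heights hU (fun n => div_pos ht (by exact_mod_cast Nat.succ_pos n))
    (tendsto_div_natCast_add_one t) (natCast_add_one_mul_div t) x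

/-- Both surfaces are the eventual value of the same discretised heights, which are determined by
the clocks alone. -/
theorem IsRSOS.unique {d : ℕ} {U : Site d → Set ℝ≥0} {f g : ℝ≥0 → Site d → ℤ}
    (hU : IsGoodClocks U) (hf : IsRSOS U 0 f) (hg : IsRSOS U 0 g) : f = g := by
  funext t x
  rcases eq_zero_or_pos t with rfl | ht
  · rw [hf.init, hg.init]
  · obtain ⟨n, h1, h2⟩ := ((hf.eventually_eq_heights_div hU ht x).and
      (hg.eventually_eq_heights_div hU ht x)).exists
    rw [h1, h2]

open Classical in
/-- The height over `x` after its clock has last rung at the greatest element of `S`, if the heights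
immediately before time `τ` are given by `G τ`. -/
noncomputable def heightAfter {d : ℕ} (G : ℝ≥0 → Site d → ℤ) (S : Set ℝ≥0) (x : Site d) : ℤ :=
  -- The value `0` is the initial height, kept as long as the clock has not rung.
  if h : ∃ τ, IsGreatest S τ then rsosRule (G h.choose) x else 0

theorem heightAfter_of_isGreatest {d : ℕ} {G : ℝ≥0 → Site d → ℤ} {S : Set ℝ≥0} {τ : ℝ≥0}
    (h : IsGreatest S τ) (x : Site d) : heightAfter G S x = rsosRule (G τ) x := by
  have h' : ∃ τ, IsGreatest S τ := ⟨τ, h⟩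
  rw [heightAfter, dif_pos h', h'.choose_spec.unique h]

theorem heightAfter_empty {d : ℕ} (G : ℝ≥0 → Site d → ℤ) (x : Site d) :
    heightAfter G ∅ x = 0 := by
  rw [heightAfter, dif_neg]
  rintro ⟨τ, h, _⟩
  exact h

theorem IsGoodClocks.exists_leftHeights {d : ℕ} {U : Site d → Set ℝ≥0} (hU : IsGoodClocks U) :
    ∃ G : ℝ≥0 → Site d → ℤ, ∀ t x, G t x = heightAfter G (U x ∩ Iio t) x := by
  classical
  let F : (p : ℝ≥0 × Site d) → ((q : ℝ≥0 × Site d) → Precedes U q p → ℤ) → ℤ := fun p ih =>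
    -- The default `0` is never read: the rule at the last ring `τ` looks only at sites of
    -- `closedNbhd p.2`, and these pairs precede `p`.
    heightAfter (fun τ y => if h : Precedes U (τ, y) p then ih (τ, y) h else 0)
      (U p.2 ∩ Iio p.1) p.2
  refine ⟨fun t x => hU.wf.fix F (t, x), fun t x => ?_⟩
  refine (hU.wf.fix_eq F (t, x)).trans ?_
  simp only [F]
  by_cases h : ∃ τ, IsGreatest (U x ∩ Iio t) τ
  · obtain ⟨τ, hτ⟩ := h
    rw [heightAfter_of_isGreatest hτ, heightAfter_of_isGreatest hτ]
    exact rsosRule_congr fun y hy => dif_pos ⟨hτ.1.2, hτ.1.1, hy⟩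
  · rw [heightAfter, heightAfter, dif_neg h, dif_neg h]

/-- Taking `Iic t` instead of `Iio t` turns heights just before `t` into heights at `t`. As only
finitely many rings over a site precede `t`, the heights at times close below `t` equal `G t`. -/
theorem IsGoodClocks.exists_isRSOS {d : ℕ} {U : Site d → Set ℝ≥0} (hU : IsGoodClocks U) :
    ∃ f, IsRSOS U 0 f := by
  obtain ⟨G, hG⟩ := hU.exists_leftHeights
  refine ⟨fun t x => heightAfter G (U x ∩ Iic t) x, fun x => ?_, fun x s t hst hd => ?_,
    fun x t ht _ => ?_⟩
  · have : U x ∩ Iic 0 = ∅ :=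
      eq_empty_of_forall_notMem fun s hs => (mem_Ioi.1 (hU.pos x hs.1)).not_ge (mem_Iic.1 hs.2)
    rw [this, heightAfter_empty]
    rfl
  · have : U x ∩ Iic t = U x ∩ Iic s := by
      ext r
      refine ⟨fun hr => ⟨hr.1, not_lt.1 fun h => disjoint_left.1 hd hr.1 ⟨h, hr.2⟩⟩,
        fun hr => ⟨hr.1, hr.2.trans hst⟩⟩
    simp only [this]
  · have h : ∀ y ∈ closedNbhd x, ∀ᶠ s in 𝓝[<] t, heightAfter G (U y ∩ Iic s) y = G t y := by
      intro y _
      have hfin : (U y ∩ Iio t).Finite :=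
        (hU.finite y t).subset (inter_subset_inter_right _ Iio_subset_Iic_self)
      have hev : ∀ᶠ s in 𝓝[<] t, ∀ r ∈ U y ∩ Iio t, r ≤ s :=
        (eventually_all_finite hfin).2 fun r hr => by
          filter_upwards [Ioo_mem_nhdsLT hr.2] with s hs using hs.1.le
      filter_upwards [hev, self_mem_nhdsWithin] with s hs hst
      have : U y ∩ Iic s = U y ∩ Iio t := by
        ext r
        exact ⟨fun hr => ⟨hr.1, mem_Iio.2 (lt_of_le_of_lt (mem_Iic.1 hr.2) hst)⟩, fun hr => ⟨hr.1, hs r hr⟩⟩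
      rw [this, hG t y]
    filter_upwards [(Finset.eventually_all _).2 h] with s hs
    have hmax : IsGreatest (U x ∩ Iic t) t := ⟨⟨ht, mem_Iic.2 le_rfl⟩, fun r hr => hr.2⟩
    rw [heightAfter_of_isGreatest hmax]
    exact rsosRule_congr fun y hy => (hs y hy).symm

theorem IsGoodClocks.existsUnique_isRSOS {d : ℕ} {U : Site d → Set ℝ≥0} (hU : IsGoodClocks U) :
    ∃! f, IsRSOS U 0 f := by
  obtain ⟨f, hf⟩ := hU.exists_isRSOS
  exact ⟨f, hf, fun g hg => hg.unique hU hf⟩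

/-- An infinite chain of dependencies is seen by all sufficiently fine discretisations. -/
theorem eventually_one_le_chainCount {d : ℕ} {U : Site d → Set ℝ≥0} (hU : ∀ x, U x ⊆ Ioi 0)
    {δ : ℕ → ℝ≥0} (hδ : ∀ n, 0 < δ n) (hδ0 : Tendsto δ atTop (𝓝 0)) (m : ℕ)
    {p : ℕ → ℝ≥0 × Site d} (hp : ∀ k, Precedes U (p (k + 1)) (p k)) :
    ∀ᶠ n in atTop, ∀ j : ℕ, (p 0).1 ≤ (j + 1) * δ n →
      1 ≤ chainCount (gridBits U (δ n)) j m (p 0).2 := by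
  induction m generalizing p with
  | zero => simp [chainCount]
  | succ m ih =>
    obtain ⟨hlt, hmem, hnb⟩ := hp 0
    have hsmall : ∀ᶠ n in atTop, δ n < (p 0).1 - (p 1).1 :=
      hδ0.eventually (gt_mem_nhds (tsub_pos_of_lt hlt))
    filter_upwards [ih (p := fun k => p (k + 1)) fun k => hp (k + 1), hsmall] with n hn hnδ j hj
    obtain ⟨i, hi, hi'⟩ := exists_slot (hδ n) (hU _ hmem)
    have hij : i < j := by
      have h1 : δ n + (p 1).1 < (p 0).1 := lt_tsub_iff_right.1 hnδ
      have h2 : (i : ℝ≥0) * δ n + δ n < j * δ n + δ n := by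
        calc (i : ℝ≥0) * δ n + δ n < (p 1).1 + δ n := by gcongr
          _ = δ n + (p 1).1 := add_comm _ _
          _ < (p 0).1 := h1
          _ ≤ j * δ n + δ n := by rwa [add_mul, one_mul] at hj
      exact_mod_cast lt_of_mul_lt_mul_right (lt_of_add_lt_add_right h2) zero_le
    refine le_trans ?_ (chainCount_mono _ hij _ _)
    rw [chainCount.eq_3, if_pos (gridBits_eq_true hmem hi hi')]
    exact (hn i hi').trans ((Finset.single_le_sum (f := fun y =>
      chainCount (gridBits U (δ n)) i m y) (fun _ _ => Nat.zero_le _) hnb).trans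
      (Nat.le_add_left _ _))

/-! ### The Efron–Stein inequality for Bernoulli variables -/

section Average

variable {ι : Type*} [DecidableEq ι]

/-- The average of `G` over coordinate `i`, which is `true` with probability `p`. -/
def bernAvg (p : ℝ) (i : ι) (G : (ι → Bool) → ℝ) (b : ι → Bool) : ℝ :=
  p * G (Function.update b i true) + (1 - p) * G (Function.update b i false)

/-- The average of `G` over the coordinates in `l`. -/
def bernAvgList (p : ℝ) (l : List ι) (G : (ι → Bool) → ℝ) : (ι → Bool) → ℝ :=
  l.foldr (bernAvg p) G

theorem bernAvgList_cons (p : ℝ) (i : ι) (l : List ι) (G : (ι → Bool) → ℝ) :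
    bernAvgList p (i :: l) G = bernAvg p i (bernAvgList p l G) := rfl

theorem bernAvgList_sub (p : ℝ) (l : List ι) (G H : (ι → Bool) → ℝ) (b : ι → Bool) :
    bernAvgList p l (fun b => G b - H b) b = bernAvgList p l G b - bernAvgList p l H b := by
  induction l generalizing b with
  | nil => rfl
  | cons i l ih =>
    simp only [bernAvgList_cons, bernAvg, ih]
    ring

/-- Jensen's inequality; for a single coordinate the defect is `p * (1 - p)` times the squared
difference of the two values. -/
theorem sq_bernAvgList_le {p : ℝ} (hp0 : 0 ≤ p) (hp1 : p ≤ 1) (l : List ι)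
    (G : (ι → Bool) → ℝ) (b : ι → Bool) :
    bernAvgList p l G b ^ 2 ≤ bernAvgList p l (fun b => G b ^ 2) b := by
  induction l generalizing b with
  | nil => exact le_rfl
  | cons i l ih =>
    simp only [bernAvgList_cons, bernAvg]
    have h1 := mul_le_mul_of_nonneg_left (ih (Function.update b i true)) hp0
    have h2 := mul_le_mul_of_nonneg_left (ih (Function.update b i false)) (sub_nonneg.2 hp1)
    have h3 := mul_nonneg (mul_nonneg hp0 (sub_nonneg.2 hp1)) (sq_nonneg
      (bernAvgList p l G (Function.update b i true) -
        bernAvgList p l G (Function.update b i false)))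
    nlinarith

theorem bernAvgList_update (p : ℝ) {i : ι} {l : List ι} (hi : i ∉ l) (G : (ι → Bool) → ℝ)
    (v : Bool) (b : ι → Bool) :
    bernAvgList p l G (Function.update b i v) =
      bernAvgList p l (fun b => G (Function.update b i v)) b := by
  induction l generalizing b with
  | nil => rfl
  | cons k l ih =>
    have hik : i ≠ k := fun h => hi (h ▸ List.mem_cons_self)
    have hil : i ∉ l := fun h => hi (List.mem_cons_of_mem _ h)
    simp only [bernAvgList_cons, bernAvg]
    rw [Function.update_comm hik, Function.update_comm hik, ih hil, ih hil]

/-- The change of `G` when coordinate `i` is flipped from `false` to `true`. -/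
def bernDiff (i : ι) (G : (ι → Bool) → ℝ) (b : ι → Bool) : ℝ :=
  G (Function.update b i true) - G (Function.update b i false)

/-- Conditioning on coordinate `i` splits the variance into the average conditional variance,
bounded by induction, and `p * (1 - p)` times the squared difference of the conditional means,
bounded by Jensen. -/
theorem bernAvgList_sq_sub_le {p : ℝ} (hp0 : 0 ≤ p) (hp1 : p ≤ 1) {l : List ι} (hl : l.Nodup)
    (G : (ι → Bool) → ℝ) (b : ι → Bool) :
    bernAvgList p l (fun b => G b ^ 2) b - bernAvgList p l G b ^ 2 ≤
      (l.map fun i => p * (1 - p) * bernAvgList p l (fun b => bernDiff i G b ^ 2) b).sum := by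
  induction l generalizing b with
  | nil => simp [bernAvgList]
  | cons i l ih =>
    obtain ⟨hi, hl⟩ := List.nodup_cons.1 hl
    have hq : 0 ≤ 1 - p := sub_nonneg.2 hp1
    -- `bernDiff i G` does not depend on coordinate `i`, so averaging over it changes nothing.
    have e1 : ∀ v, bernAvgList p l (fun b => bernDiff i G b ^ 2) (Function.update b i v) =
        bernAvgList p l (fun b => bernDiff i G b ^ 2) b := fun v => by
      rw [bernAvgList_update p hi]
      simp only [bernDiff, Function.update_idem]
    have e2 : bernAvgList p l G (Function.update b i true) -
        bernAvgList p l G (Function.update b i false) = bernAvgList p l (bernDiff i G) b := by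
      rw [bernAvgList_update p hi, bernAvgList_update p hi, ← bernAvgList_sub]
      rfl
    have h1 := sq_bernAvgList_le hp0 hp1 l (bernDiff i G) b
    rw [← e2] at h1
    have h2 := mul_le_mul_of_nonneg_left h1 (mul_nonneg hp0 hq)
    have h3 := mul_le_mul_of_nonneg_left (ih hl (Function.update b i true)) hp0
    have h4 := mul_le_mul_of_nonneg_left (ih hl (Function.update b i false)) hq
    have e3 : (l.map fun k => p * (1 - p) *
        bernAvgList p (i :: l) (fun b => bernDiff k G b ^ 2) b).sum =
        p * (l.map fun k => p * (1 - p) *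
          bernAvgList p l (fun b => bernDiff k G b ^ 2) (Function.update b i true)).sum +
        (1 - p) * (l.map fun k => p * (1 - p) *
          bernAvgList p l (fun b => bernDiff k G b ^ 2) (Function.update b i false)).sum := by
      rw [← List.sum_map_mul_left, ← List.sum_map_mul_left, ← List.sum_map_add]
      congr 1
      refine List.map_congr_left fun k _ => ?_
      rw [bernAvgList_cons, bernAvg]
      ring
    rw [List.map_cons, List.sum_cons, e3]
    simp only [bernAvgList_cons, bernAvg, e1]
    nlinarith

theorem DependsOn.bernAvg {p : ℝ} {i : ι} {G : (ι → Bool) → ℝ} {L : Set ι}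
    (hG : DependsOn G L) : DependsOn (bernAvg p i G) (L \ {i}) := by
  intro b b' h
  have : ∀ v, G (Function.update b i v) = G (Function.update b' i v) := fun v => hG fun k hk => by
    by_cases hki : k = i
    · subst hki; simp
    · rw [Function.update_of_ne hki, Function.update_of_ne hki, h k ⟨hk, hki⟩]
  rw [_root_.bernAvg, _root_.bernAvg, this, this]

theorem DependsOn.bernAvgList {p : ℝ} {l : List ι} {G : (ι → Bool) → ℝ} {L : Set ι}
    (hG : DependsOn G L) : DependsOn (bernAvgList p l G) (L \ {i | i ∈ l}) := by
  induction l with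
  | nil => simpa [_root_.bernAvgList] using hG
  | cons i l ih =>
    rw [bernAvgList_cons]
    refine ih.bernAvg.mono fun k hk => ⟨hk.1.1, fun h => ?_⟩
    rcases List.mem_cons.1 h with h | h
    · exact hk.2 h
    · exact hk.1.2 h

theorem DependsOn.comp_update {i : ι} {G : (ι → Bool) → ℝ} {L : Set ι} (hG : DependsOn G L)
    (v : Bool) : DependsOn (fun b => G (Function.update b i v)) (L \ {i}) := by
  intro b b' h
  refine hG fun k hk => ?_
  by_cases hki : k = i
  · subst hki; simp
  · rw [Function.update_of_ne hki, Function.update_of_ne hki, h k ⟨hk, hki⟩]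

end Average

/-! ### Expectations of functions of finitely many independent bits -/

section Expectation

variable {ι Ω : Type*} [MeasurableSpace Ω] {μ : Measure Ω} {B : ι → Ω → Bool}

theorem DependsOn.measurable_comp {β : Type*} [Nonempty β] [MeasurableSpace β]
    {G : (ι → Bool) → β} {L : Finset ι} (hG : DependsOn G (L : Set ι))
    (hB : ∀ i, Measurable (B i)) : Measurable fun ω => G (fun i => B i ω) := by
  obtain ⟨g, rfl⟩ := dependsOn_iff_exists_comp.1 hG
  exact (measurable_of_finite g).comp (measurable_pi_lambda _ fun i => hB i)

theorem DependsOn.memLp_comp [IsFiniteMeasure μ] {G : (ι → Bool) → ℝ} {L : Finset ι}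
    (hG : DependsOn G (L : Set ι)) (hB : ∀ i, Measurable (B i)) (q : ENNReal) :
    MemLp (fun ω => G (fun i => B i ω)) q μ := by
  have hm := hG.measurable_comp hB
  obtain ⟨g, rfl⟩ := dependsOn_iff_exists_comp.1 hG
  obtain ⟨C, hC⟩ := (Set.finite_range fun c => ‖g c‖).bddAbove
  exact MemLp.of_bound hm.aestronglyMeasurable C
    (Eventually.of_forall fun ω => hC ⟨_, rfl⟩)

theorem DependsOn.integrable_comp [IsFiniteMeasure μ] {G : (ι → Bool) → ℝ} {L : Finset ι}
    (hG : DependsOn G (L : Set ι)) (hB : ∀ i, Measurable (B i)) :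
    Integrable (fun ω => G (fun i => B i ω)) μ :=
  memLp_one_iff_integrable.1 (hG.memLp_comp hB 1)

theorem integral_indicator_mul_comp (hB : ∀ i, Measurable (B i)) (hind : iIndepFun B μ)
    {i : ι} {v : Bool} {G : (ι → Bool) → ℝ} {L : Finset ι} (hi : i ∉ L)
    (hG : DependsOn G (L : Set ι)) :
    ∫ ω, (if B i ω = v then 1 else 0) * G (fun i => B i ω) ∂μ =
      μ.real {ω | B i ω = v} * ∫ ω, G (fun i => B i ω) ∂μ := by
  classical
  obtain ⟨g, rfl⟩ := dependsOn_iff_exists_comp.1 hG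
  have h := hind.indepFun_finset {i} L (Finset.disjoint_singleton_left.2 hi) hB
  have h' := h.integral_fun_comp_mul_comp
    (f := fun c : ({i} : Finset ι) → Bool =>
      if c ⟨i, Finset.mem_singleton_self i⟩ = v then (1 : ℝ) else 0) (g := g)
    (measurable_pi_lambda _ fun i => hB _).aemeasurable
    (measurable_pi_lambda _ fun i => hB _).aemeasurable
    (measurable_of_finite _).aestronglyMeasurable (measurable_of_finite _).aestronglyMeasurable
  refine h'.trans ?_
  congr 1
  refine Eq.trans ?_ (integral_indicator_one (μ := μ) (hB i (measurableSet_singleton v)))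
  congr 1
  ext ω
  simp [indicator]

variable [DecidableEq ι] {p : ℝ}

/-- Split by the value of `B i`: with coordinate `i` frozen, `G` depends only on other bits and is
independent of `B i`. -/
theorem integral_comp_eq_integral_bernAvg [IsProbabilityMeasure μ] (hB : ∀ i, Measurable (B i))
    (hind : iIndepFun B μ) (hp : ∀ i, μ.real {ω | B i ω = true} = p) {G : (ι → Bool) → ℝ}
    {L : Finset ι} (hG : DependsOn G (L : Set ι)) (i : ι) :
    ∫ ω, G (fun i => B i ω) ∂μ = ∫ ω, bernAvg p i G (fun i => B i ω) ∂μ := by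
  have hp' : μ.real {ω | B i ω = false} = 1 - p := by
    have h := probReal_compl_eq_one_sub (μ := μ) (hB i (measurableSet_singleton true))
    rw [← hp i]
    refine Eq.trans ?_ h
    congr 1
    ext ω
    simp
  have hd : ∀ v, DependsOn (fun b => G (Function.update b i v)) ((L.erase i : Finset ι) : Set ι) :=
    fun v => by simpa using hG.comp_update (i := i) v
  have hind' : ∀ v, Integrable (fun ω => (if B i ω = v then (1 : ℝ) else 0) *
      G (Function.update (fun i => B i ω) i v)) μ := fun v =>
    ((hd v).integrable_comp hB).bdd_mul (c := 1)
      (Measurable.ite (hB i (measurableSet_singleton v)) measurable_const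
        measurable_const).aestronglyMeasurable
      (Eventually.of_forall fun ω => by split_ifs <;> simp)
  calc ∫ ω, G (fun i => B i ω) ∂μ
      = ∫ ω, ((if B i ω = true then 1 else 0) * G (Function.update (fun i => B i ω) i true) +
        (if B i ω = false then 1 else 0) * G (Function.update (fun i => B i ω) i false)) ∂μ := by
        congr 1
        ext ω
        have := Function.update_eq_self i (fun i => B i ω)
        rcases h : B i ω <;> rw [h] at this <;> simp [this]
    _ = p * ∫ ω, G (Function.update (fun i => B i ω) i true) ∂μ +
        (1 - p) * ∫ ω, G (Function.update (fun i => B i ω) i false) ∂μ := by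
        rw [integral_add (hind' true) (hind' false),
          integral_indicator_mul_comp hB hind (L.notMem_erase i) (hd true),
          integral_indicator_mul_comp hB hind (L.notMem_erase i) (hd false), hp, hp']
    _ = ∫ ω, bernAvg p i G (fun i => B i ω) ∂μ := by
        rw [← integral_const_mul, ← integral_const_mul, ← integral_add
          (((hd true).integrable_comp hB).const_mul _)
          (((hd false).integrable_comp hB).const_mul _)]
        rfl

/-- Averaging over all of `L` leaves a constant, so the base point `b` is arbitrary. -/
theorem integral_comp_eq_bernAvgList [IsProbabilityMeasure μ] (hB : ∀ i, Measurable (B i))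
    (hind : iIndepFun B μ) (hp : ∀ i, μ.real {ω | B i ω = true} = p) {G : (ι → Bool) → ℝ}
    {L : Finset ι} (hG : DependsOn G (L : Set ι)) (b : ι → Bool) :
    ∫ ω, G (fun i => B i ω) ∂μ = bernAvgList p L.toList G b := by
  have h : ∀ l : List ι,
      ∫ ω, G (fun i => B i ω) ∂μ = ∫ ω, bernAvgList p l G (fun i => B i ω) ∂μ := by
    intro l
    induction l with
    | nil => rfl
    | cons i l ih =>
      rw [ih, bernAvgList_cons]
      exact integral_comp_eq_integral_bernAvg hB hind hp (hG.bernAvgList.mono sdiff_subset) i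
  have hd : DependsOn (bernAvgList p L.toList G) ∅ := by
    have := hG.bernAvgList (p := p) (l := L.toList)
    simpa using this
  rw [h L.toList]
  simp only [fun ω => hd.empty (fun i => B i ω) b]
  simp

/-- The Efron–Stein inequality. -/
theorem variance_comp_le [IsProbabilityMeasure μ] (hB : ∀ i, Measurable (B i))
    (hind : iIndepFun B μ) (hp0 : 0 ≤ p) (hp1 : p ≤ 1)
    (hp : ∀ i, μ.real {ω | B i ω = true} = p) {G : (ι → Bool) → ℝ}
    {L : Finset ι} (hG : DependsOn G (L : Set ι)) :
    Var[fun ω => G (fun i => B i ω); μ] ≤ p * ∫ ω, ∑ i ∈ L, (if B i ω = false then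
      (G (Function.update (fun i => B i ω) i true) - G (fun i => B i ω)) ^ 2 else 0) ∂μ := by
  let K : ι → (ι → Bool) → ℝ := fun i b =>
    if b i = false then (G (Function.update b i true) - G b) ^ 2 else 0
  have hup : ∀ i ∈ L, ∀ v, DependsOn (fun b => G (Function.update b i v)) (L : Set ι) :=
    fun i _ v => (hG.comp_update v).mono sdiff_subset
  have hK : ∀ i ∈ L, DependsOn (K i) (L : Set ι) := by
    intro i hi b b' h
    have h1 := hup i hi true h
    dsimp only at h1
    simp only [K]
    rw [h i hi, h1, hG h]
  have hsq : DependsOn (fun b => G b ^ 2) (L : Set ι) := fun b b' h => by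
    simp only [hG h]
  have hdiff : ∀ i ∈ L, DependsOn (fun b => bernDiff i G b ^ 2) (L : Set ι) := by
    intro i hi b b' h
    have h1 := hup i hi true h
    have h2 := hup i hi false h
    dsimp only at h1 h2
    simp only [bernDiff, h1, h2]
  let b₀ : ι → Bool := fun _ => false
  rw [variance_eq_sub (hG.memLp_comp hB 2)]
  have e1 : ∫ ω, ((fun ω => G (fun i => B i ω)) ^ 2) ω ∂μ =
      bernAvgList p L.toList (fun b => G b ^ 2) b₀ :=
    integral_comp_eq_bernAvgList hB hind hp hsq b₀
  rw [e1, integral_comp_eq_bernAvgList hB hind hp hG b₀]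
  refine (bernAvgList_sq_sub_le hp0 hp1 L.nodup_toList G b₀).trans_eq ?_
  rw [Finset.sum_map_toList, integral_finsetSum _ fun i hi => (hK i hi).integrable_comp hB,
    Finset.mul_sum]
  refine Finset.sum_congr rfl fun i hi => ?_
  -- Only the value `false` contributes to the average of `K i` over coordinate `i`; its weight is
  -- the factor `1 - p`.
  rw [← integral_comp_eq_bernAvgList hB hind hp (hdiff i hi) b₀, mul_assoc,
    integral_comp_eq_integral_bernAvg hB hind hp (hK i hi) i, ← integral_const_mul]
  congr 2
  ext ω
  simp [bernAvg, bernDiff, K]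

end Expectation

/-! ### Discretised Poisson clocks -/

section Clocks

variable {d : ℕ} {Ω : Type*}

theorem gridBits_eq_decide_ringCount {U : Site d → Ω → Set ℝ≥0} (δ : ℝ≥0) (x : Site d) (k : ℕ) (ω : Ω) :
    gridBits (fun x => U x ω) δ (x, k) =
      decide (ringCount (U x) (k * δ, (k + 1) * δ) ω ≠ 0) := by
  simp only [gridBits, ringCount, ne_eq, encard_eq_zero, nonempty_iff_ne_empty]

variable [MeasurableSpace Ω] {μ : Measure Ω} {U : Site d → Ω → Set ℝ≥0}

theorem ArePoissonClocks.measurable_gridBits (hU : ArePoissonClocks U μ) (δ : ℝ≥0)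
    (i : Site d × ℕ) : Measurable fun ω => gridBits (fun x => U x ω) δ i := by
  obtain ⟨x, k⟩ := i
  simp only [gridBits_eq_decide_ringCount]
  exact (Measurable.of_discrete (f := fun n : ℕ∞ => decide (n ≠ 0))).comp
    ((hU.clock x).measurable_count _)

theorem IsPoissonClock.iIndepFun_ringCount {T : Ω → Set ℝ≥0} (hT : IsPoissonClock T μ)
    (δ : ℝ≥0) :
    iIndepFun (fun (k : ℕ) ω => ringCount T (k * δ, (k + 1) * δ) ω) μ := by
  rw [iIndepFun_iff_finset]
  intro s
  obtain ⟨n, hn⟩ := s.exists_nat_subset_range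
  have h := hT.indep_count n (fun i => (i : ℕ) * δ) fun i j hij => by
    dsimp only
    gcongr
    exact_mod_cast hij
  have h' := h.precomp (g := fun k : s => (⟨k, Finset.mem_range.1 (hn k.2)⟩ : Fin n))
    fun k l hkl => Subtype.ext (Fin.mk.inj hkl)
  convert! h' using 3
  simp

/-- Independence between sites and independent increments at each site combine to independence of
the double array. -/
theorem ArePoissonClocks.iIndepFun_gridBits (hU : ArePoissonClocks U μ) (δ : ℝ≥0) :
    iIndepFun (fun i ω => gridBits (fun x => U x ω) δ i) μ := by
  refine iIndepFun_uncurry' (X := fun x k ω => gridBits (fun x => U x ω) δ (x, k))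
    (fun x k => hU.measurable_gridBits δ (x, k)) ?_ fun x => ?_
  · simp only [gridBits_eq_decide_ringCount]
    exact hU.indep.comp (fun _ c (k : ℕ) => decide (c ((k : ℝ≥0) * δ, (k + 1) * δ) ≠ 0))
      fun _ => measurable_pi_lambda _ fun k =>
        (Measurable.of_discrete (f := fun n : ℕ∞ => decide (n ≠ 0))).comp (measurable_pi_apply _)
  · simp only [gridBits_eq_decide_ringCount]
    exact ((hU.clock x).iIndepFun_ringCount δ).comp (fun _ n => decide (n ≠ 0))
      fun _ => Measurable.of_discrete

theorem ArePoissonClocks.measureReal_gridBits [IsProbabilityMeasure μ]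
    (hU : ArePoissonClocks U μ) (δ : ℝ≥0) (i : Site d × ℕ) :
    μ.real {ω | gridBits (fun x => U x ω) δ i = true} = 1 - Real.exp (-δ) := by
  obtain ⟨x, k⟩ := i
  have hm := (hU.clock x).measurable_count ((k : ℝ≥0) * δ, (k + 1) * δ)
  have hle : (k : ℝ≥0) * δ ≤ (k + 1) * δ := by gcongr; simp
  have hlaw := (hU.clock x).law_count _ _ hle
  have hsub : ((k : ℝ≥0) + 1) * δ - k * δ = δ := by
    rw [add_mul, one_mul, add_tsub_cancel_left]
  have h0 : μ.real {ω | ringCount (U x) (k * δ, (k + 1) * δ) ω = 0} = Real.exp (-δ) := by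
    have h1 := congrArg (fun ν => ν {0}) hlaw
    rw [hsub] at h1
    simp only [Measure.map_apply hm (measurableSet_singleton _),
      Measure.map_apply (Measurable.of_discrete (f := (Nat.cast : ℕ → ℕ∞)))
      (measurableSet_singleton _)] at h1
    have h2 : (Nat.cast : ℕ → ℕ∞) ⁻¹' {0} = {0} := by ext; simp
    rw [h2] at h1
    have h3 := poissonMeasure_real_singleton δ 0
    rw [measureReal_def, ← h1] at h3
    refine h3.trans ?_
    simp
  rw [← h0]
  have h := probReal_compl_eq_one_sub (μ := μ) (hm (measurableSet_singleton 0))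
  refine Eq.trans ?_ h
  congr 1
  ext ω
  simp [gridBits_eq_decide_ringCount]

/-- The law of a count is carried by `ℕ`, so `⊤` has no mass; integer horizons suffice. -/
theorem IsPoissonClock.ae_finite {T : Ω → Set ℝ≥0} (hT : IsPoissonClock T μ) :
    ∀ᵐ ω ∂μ, ∀ t, (T ω ∩ Iic t).Finite := by
  have h : ∀ n : ℕ, ∀ᵐ ω ∂μ, ringCount T (0, n) ω ≠ ⊤ := by
    intro n
    have h1 := congrArg (fun ν => ν {⊤}) (hT.law_count 0 n zero_le)
    simp only [Measure.map_apply (hT.measurable_count _) (measurableSet_singleton _),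
      Measure.map_apply (Measurable.of_discrete (f := (Nat.cast : ℕ → ℕ∞)))
      (measurableSet_singleton _)] at h1
    have h2 : (Nat.cast : ℕ → ℕ∞) ⁻¹' {⊤} = ∅ := by ext; simp
    rw [h2, measure_empty] at h1
    rw [ae_iff]
    simpa only [not_not] using! h1
  filter_upwards [ae_all_iff.2 h] with ω hω t
  obtain ⟨n, hn⟩ := exists_nat_ge t
  refine (encard_ne_top_iff.1 (hω n)).subset fun s hs => ⟨hs.1, hT.pos ω hs.1, ?_⟩
  exact (mem_Iic.1 hs.2).trans hn

end Clocks

/-! ### Almost surely there is no infinite chain of dependencies -/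

section Chains

variable {d : ℕ} {Ω : Type*} [MeasurableSpace Ω] {μ : Measure Ω}

/-- The bit of round `k` is independent of the chains in earlier rounds, so a new link costs a
factor `p` and offers at most `2 * d + 1` sites; Pascal's rule does the rest. -/
theorem integral_chainCount_le [IsProbabilityMeasure μ] {B : Site d × ℕ → Ω → Bool}
    (hB : ∀ i, Measurable (B i)) (hind : iIndepFun B μ) {p : ℝ} (hp0 : 0 ≤ p)
    (hp : ∀ i, μ.real {ω | B i ω = true} = p) (k m : ℕ) (x : Site d) :
    ∫ ω, (chainCount (fun i => B i ω) k m x : ℝ) ∂μ ≤ ((2 * d + 1) * p) ^ m * k.choose m := by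
  have hdep : ∀ k m x, ∃ L : Finset (Site d × ℕ), (∀ i ∈ L, i.2 < k) ∧
      DependsOn (fun b : Site d × ℕ → Bool => (chainCount b k m x : ℝ))
        (L : Set (Site d × ℕ)) := fun k m x => by
    obtain ⟨L, hL, h⟩ := exists_dependsOn_chainCount k m x
    exact ⟨L, hL, fun b b' hb => congrArg Nat.cast (h hb)⟩
  induction k generalizing m x with
  | zero => cases m <;> simp [chainCount]
  | succ k ih =>
    cases m with
    | zero => simp [chainCount]
    | succ m =>
    have hterm : ∀ y, Integrable (fun ω => (if B (x, k) ω = true then (1 : ℝ) else 0) *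
        chainCount (fun i => B i ω) k m y) μ := fun y => by
      obtain ⟨L, -, h⟩ := hdep k m y
      exact (h.integrable_comp hB).bdd_mul (c := 1)
        (Measurable.ite (hB (x, k) (measurableSet_singleton true)) measurable_const
          measurable_const).aestronglyMeasurable
        (Eventually.of_forall fun ω => by split_ifs <;> simp)
    obtain ⟨L, -, hL⟩ := hdep k (m + 1) x
    have e : ∀ ω, (chainCount (fun i => B i ω) (k + 1) (m + 1) x : ℝ) =
        chainCount (fun i => B i ω) k (m + 1) x + ∑ y ∈ closedNbhd x,
          (if B (x, k) ω = true then (1 : ℝ) else 0) * chainCount (fun i => B i ω) k m y := by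
      intro ω
      rw [chainCount.eq_3]
      split_ifs <;> simp
    simp only [e]
    rw [integral_add (hL.integrable_comp hB) (integrable_finsetSum _ fun y _ => hterm y),
      integral_finsetSum _ fun y _ => hterm y, Nat.choose_succ_succ, Nat.cast_add, mul_add,
      add_comm]
    refine add_le_add ?_ (ih _ _)
    have hy : ∀ y ∈ closedNbhd x, ∫ ω, (if B (x, k) ω = true then (1 : ℝ) else 0) *
        chainCount (fun i => B i ω) k m y ∂μ ≤ p * (((2 * d + 1) * p) ^ m * k.choose m) := by
      intro y _
      obtain ⟨L, hL, h⟩ := hdep k m y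
      rw [integral_indicator_mul_comp hB hind (fun hx => (hL _ hx).ne rfl) h, hp]
      exact mul_le_mul_of_nonneg_left (ih m y) hp0
    refine (Finset.sum_le_card_nsmul _ _ _ hy).trans ?_
    have hc : ((closedNbhd x).card : ℝ) ≤ 2 * d + 1 := by exact_mod_cast card_closedNbhd_le x
    rw [nsmul_eq_mul]
    calc ((closedNbhd x).card : ℝ) * (p * (((2 * d + 1) * p) ^ m * k.choose m))
        ≤ (2 * d + 1) * (p * (((2 * d + 1) * p) ^ m * k.choose m)) := by gcongr
      _ = ((2 * d + 1) * p) ^ (m + 1) * k.choose m := by ring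

variable {U : Site d → Ω → Set ℝ≥0}

theorem one_sub_exp_neg_nonneg (δ : ℝ≥0) : 0 ≤ 1 - Real.exp (-δ) :=
  sub_nonneg.2 (Real.exp_le_one_iff.2 (neg_nonpos.2 δ.2))

theorem mul_one_sub_exp_neg_div_le (t : ℝ≥0) (n : ℕ) :
    ((n + 1 : ℕ) : ℝ) * (1 - Real.exp (-(t / ((n + 1 : ℕ) : ℝ≥0) : ℝ≥0))) ≤ t := by
  have h := Real.add_one_le_exp (-((t / ((n + 1 : ℕ) : ℝ≥0) : ℝ≥0) : ℝ))
  have h2 : ((n + 1 : ℕ) : ℝ) * ((t / ((n + 1 : ℕ) : ℝ≥0) : ℝ≥0) : ℝ) = t := by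
    exact_mod_cast natCast_add_one_mul_div t n
  calc _ ≤ ((n + 1 : ℕ) : ℝ) * ((t / ((n + 1 : ℕ) : ℝ≥0) : ℝ≥0) : ℝ) := by
        gcongr
        linarith
    _ = t := h2

/-- By Markov and Fatou the measure is at most the bound on the mean number of chains of length `m`,
for every `m`; this bound tends to `0`. -/
theorem ArePoissonClocks.measure_forall_eventually_chainCount [IsProbabilityMeasure μ]
    (hU : ArePoissonClocks U μ) (t : ℝ≥0) (x : Site d) :
    μ {ω | ∀ m, ∀ᶠ n : ℕ in atTop, 1 ≤ chainCount
      (gridBits (fun x => U x ω) (t / ((n + 1 : ℕ) : ℝ≥0))) (n + 1) m x} = 0 := by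
  set c : ℕ → ℕ → Ω → ℝ := fun m n ω => chainCount
      (gridBits (fun x => U x ω) (t / ((n + 1 : ℕ) : ℝ≥0))) (n + 1) m x with hc
  have hdep : ∀ m n, ∃ L : Finset (Site d × ℕ),
      DependsOn (fun b : Site d × ℕ → Bool => (chainCount b (n + 1) m x : ℝ))
        (L : Set (Site d × ℕ)) := fun m n => by
    obtain ⟨L, -, h⟩ := exists_dependsOn_chainCount (n + 1) m x
    exact ⟨L, fun b b' hb => congrArg Nat.cast (h hb)⟩
  have hcm : ∀ m n, Measurable (c m n) := fun m n => by
    obtain ⟨L, h⟩ := hdep m n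
    exact h.measurable_comp (hU.measurable_gridBits _)
  have hci : ∀ m n, Integrable (c m n) μ := fun m n => by
    obtain ⟨L, h⟩ := hdep m n
    exact h.integrable_comp (hU.measurable_gridBits _)
  have hbound : ∀ m n, ∫ ω, c m n ω ∂μ ≤ ((2 * d + 1) * t) ^ m / m.factorial := by
    intro m n
    have hp0 := one_sub_exp_neg_nonneg (t / ((n + 1 : ℕ) : ℝ≥0))
    refine (integral_chainCount_le (hU.measurable_gridBits _) (hU.iIndepFun_gridBits _)
      hp0 (hU.measureReal_gridBits _) (n + 1) m x).trans ?_
    set p := 1 - Real.exp (-(t / ((n + 1 : ℕ) : ℝ≥0) : ℝ≥0))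
    have hpt : ((n + 1 : ℕ) : ℝ) * p ≤ t := mul_one_sub_exp_neg_div_le t n
    calc ((2 * d + 1) * p) ^ m * (n + 1).choose m
        ≤ ((2 * d + 1) * p) ^ m * (((n + 1 : ℕ) : ℝ) ^ m / m.factorial) := by
          gcongr
          exact Nat.choose_le_pow_div m (n + 1)
      _ = ((2 * d + 1) * (((n + 1 : ℕ) : ℝ) * p)) ^ m / m.factorial := by
          rw [mul_div_assoc', ← mul_pow]
          congr 2
          ring
      _ ≤ ((2 * d + 1) * t) ^ m / m.factorial := by gcongr
  have hle : ∀ m, μ {ω | ∀ m, ∀ᶠ n : ℕ in atTop, 1 ≤ chainCount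
      (gridBits (fun x => U x ω) (t / ((n + 1 : ℕ) : ℝ≥0))) (n + 1) m x} ≤
      ENNReal.ofReal (((2 * d + 1) * t) ^ m / m.factorial) := by
    intro m
    have hcm' : ∀ n, Measurable fun ω => ENNReal.ofReal (c m n ω) :=
      fun n => (hcm m n).ennreal_ofReal
    calc _ ≤ μ {ω | 1 ≤ liminf (fun n => ENNReal.ofReal (c m n ω)) atTop} := by
          refine measure_mono fun ω hω => mem_ofPred.2 ?_
          refine le_liminf_of_le (by isBoundedDefault) ?_
          filter_upwards [hω m] with n hn
          rw [← ENNReal.ofReal_one]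
          exact ENNReal.ofReal_le_ofReal (by simp only [hc]; exact_mod_cast hn)
      _ ≤ ∫⁻ ω, liminf (fun n => ENNReal.ofReal (c m n ω)) atTop ∂μ := by
          simpa using mul_meas_ge_le_lintegral (μ := μ) (Measurable.liminf hcm') 1
      _ ≤ liminf (fun n => ∫⁻ ω, ENNReal.ofReal (c m n ω) ∂μ) atTop := lintegral_liminf_le hcm'
      _ ≤ ENNReal.ofReal (((2 * d + 1) * t) ^ m / m.factorial) := by
          refine liminf_le_of_frequently_le' (Frequently.of_forall fun n => ?_)
          rw [← ofReal_integral_eq_lintegral_ofReal (hci m n)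
            (Eventually.of_forall fun ω => Nat.cast_nonneg _)]
          exact ENNReal.ofReal_le_ofReal (hbound m n)
  have hlim : Tendsto (fun m : ℕ => ENNReal.ofReal (((2 * d + 1) * t) ^ m / m.factorial)) atTop
      (𝓝 0) := by
    have := ENNReal.tendsto_ofReal
      (FloorSemiring.tendsto_pow_div_factorial_atTop ((2 * d + 1) * (t : ℝ)))
    rwa [ENNReal.ofReal_zero] at this
  exact le_antisymm (ge_of_tendsto' hlim hle) zero_le

/-- A chain may start at any real time, but it is seen by the discretisations of every later integer
horizon, so countably many null sets suffice. -/
theorem ArePoissonClocks.ae_wellFounded [IsProbabilityMeasure μ] (hU : ArePoissonClocks U μ) :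
    ∀ᵐ ω ∂μ, WellFounded (Precedes fun x => U x ω) := by
  have h : ∀ q : ℕ × Site d, ∀ᵐ ω ∂μ, ¬ ∀ m, ∀ᶠ n : ℕ in atTop, 1 ≤ chainCount
      (gridBits (fun x => U x ω) (((q.1 + 1 : ℕ) : ℝ≥0) / ((n + 1 : ℕ) : ℝ≥0))) (n + 1) m q.2 := by
    intro q
    rw [ae_iff]
    simp only [not_not]
    exact hU.measure_forall_eventually_chainCount ((q.1 + 1 : ℕ) : ℝ≥0) q.2
  filter_upwards [ae_all_iff.2 h] with ω hω
  rw [wellFounded_iff_isEmpty_descending_chain]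
  refine ⟨fun ⟨p, hp⟩ => ?_⟩
  obtain ⟨N, hN⟩ := exists_nat_ge (p 0).1
  refine hω (N, (p 0).2) fun m => ?_
  -- The horizon is `N + 1` so that the mesh is positive even if `N = 0`.
  have hpos : ∀ n : ℕ, 0 < ((N + 1 : ℕ) : ℝ≥0) / ((n + 1 : ℕ) : ℝ≥0) := fun n =>
    div_pos (by exact_mod_cast Nat.succ_pos N) (by exact_mod_cast Nat.succ_pos n)
  filter_upwards [eventually_one_le_chainCount (fun x => (hU.clock x).pos ω) hpos
    (tendsto_div_natCast_add_one _) m hp] with n hn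
  refine hn (n + 1) ?_
  calc (p 0).1 ≤ ((N + 1 : ℕ) : ℝ≥0) := hN.trans (by exact_mod_cast Nat.le_succ N)
    _ = ((n + 1 : ℕ) : ℝ≥0) * (((N + 1 : ℕ) : ℝ≥0) / ((n + 1 : ℕ) : ℝ≥0)) :=
      (natCast_add_one_mul_div _ n).symm
    _ ≤ (((n + 1 : ℕ) : ℝ≥0) + 1) * (((N + 1 : ℕ) : ℝ≥0) / ((n + 1 : ℕ) : ℝ≥0)) := by
      gcongr
      simp

theorem ArePoissonClocks.ae_isGoodClocks [IsProbabilityMeasure μ] (hU : ArePoissonClocks U μ) :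
    ∀ᵐ ω ∂μ, IsGoodClocks fun x => U x ω := by
  filter_upwards [hU.ae_wellFounded, ae_all_iff.2 fun x => (hU.clock x).ae_finite] with ω h1 h2
  exact ⟨fun x => (hU.clock x).pos ω, h2, h1⟩

end Chains

/-! ### The variance of the height -/

/-- A bound on the variances passes to almost sure limits, provided that the means are bounded. -/
theorem memLp_two_and_variance_le_of_tendsto {Ω : Type*} [MeasurableSpace Ω] {μ : Measure Ω}
    [IsProbabilityMeasure μ] {X : ℕ → Ω → ℝ} {Y : Ω → ℝ} {C v : ℝ} (hX : ∀ n, MemLp (X n) 2 μ)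
    (hmean : ∀ n, μ[X n] ∈ Icc 0 C) (hvar : ∀ n, Var[X n; μ] ≤ v)
    (hlim : ∀ᵐ ω ∂μ, Tendsto (fun n => X n ω) atTop (𝓝 (Y ω))) :
    MemLp Y 2 μ ∧ Var[Y; μ] ≤ v := by
  have hv : 0 ≤ v := (variance_nonneg _ _).trans (hvar 0)
  -- The limit `a` of the means along a subsequence need not be identified with the mean of `Y`:
  -- Fatou bounds the second moment of `Y` about `a`, which dominates the variance.
  obtain ⟨a, -, φ, hφ, ha⟩ := isCompact_Icc.tendsto_subseq hmean
  have hY : AEStronglyMeasurable Y μ := aestronglyMeasurable_of_tendsto_ae atTop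
    (fun n => (hX n).aestronglyMeasurable) hlim
  have hZ : AEStronglyMeasurable (fun ω => Y ω - a) μ := hY.sub aestronglyMeasurable_const
  have hfatou : ∫⁻ ω, ENNReal.ofReal ((Y ω - a) ^ 2) ∂μ ≤ ENNReal.ofReal v := by
    calc ∫⁻ ω, ENNReal.ofReal ((Y ω - a) ^ 2) ∂μ
        = ∫⁻ ω, liminf (fun n => ENNReal.ofReal ((X (φ n) ω - μ[X (φ n)]) ^ 2)) atTop ∂μ := by
          refine lintegral_congr_ae ?_
          filter_upwards [hlim] with ω hω
          exact ((ENNReal.continuous_ofReal.tendsto _).comp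
            (((hω.comp hφ.tendsto_atTop).sub ha).pow 2)).liminf_eq.symm
      _ ≤ liminf (fun n => ∫⁻ ω, ENNReal.ofReal ((X (φ n) ω - μ[X (φ n)]) ^ 2) ∂μ) atTop :=
          lintegral_liminf_le' fun n =>
            (((hX (φ n)).aemeasurable.sub_const _).pow_const 2).ennreal_ofReal
      _ ≤ ENNReal.ofReal v := by
          refine liminf_le_of_frequently_le' (Frequently.of_forall fun n => ?_)
          rw [← evariance_eq_lintegral_ofReal, ← ofReal_variance (hX (φ n))]
          exact ENNReal.ofReal_le_ofReal (hvar (φ n))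
  have hint : Integrable (fun ω => (Y ω - a) ^ 2) μ := by
    refine ⟨hZ.pow 2, ?_⟩
    rw [hasFiniteIntegral_iff_ofReal (Eventually.of_forall fun ω => sq_nonneg _)]
    exact hfatou.trans_lt ENNReal.ofReal_lt_top
  have hZ2 : MemLp (fun ω => Y ω - a) 2 μ := (memLp_two_iff_integrable_sq hZ).2 hint
  have hY2 : MemLp Y 2 μ := by
    have h := hZ2.add (memLp_const (μ := μ) a)
    have e : (fun ω => Y ω - a) + (fun _ => a) = Y := by
      ext ω
      simp
    rwa [e] at h
  refine ⟨hY2, ?_⟩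
  rw [← variance_sub_const hY a]
  refine (variance_le_expectation_sq hZ).trans ?_
  rw [← ENNReal.ofReal_le_ofReal_iff hv]
  refine le_trans (le_of_eq ?_) hfatou
  exact ofReal_integral_eq_lintegral_ofReal hint (Eventually.of_forall fun ω => sq_nonneg _)

section Variance

variable {d : ℕ} {Ω : Type*} [MeasurableSpace Ω] {μ : Measure Ω} [IsProbabilityMeasure μ]

theorem exists_dependsOn_heights_cast (k : ℕ) (x : Site d) :
    ∃ L : Finset (Site d × ℕ), (∀ i ∈ L, i.2 < k) ∧
      DependsOn (fun b : Site d × ℕ → Bool => (heights b k x : ℝ)) (L : Set (Site d × ℕ)) := by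
  obtain ⟨L, hL, h⟩ := exists_dependsOn_heights k x
  exact ⟨L, hL, fun b b' hb => congrArg Int.cast (h hb)⟩

variable {B : Site d × ℕ → Ω → Bool} {p : ℝ}

theorem variance_heights_le (hB : ∀ i, Measurable (B i)) (hind : iIndepFun B μ) (hp0 : 0 ≤ p)
    (hp1 : p ≤ 1) (hp : ∀ i, μ.real {ω | B i ω = true} = p) (k : ℕ) (x : Site d) :
    Var[fun ω => (heights (fun i => B i ω) k x : ℝ); μ] ≤ k * p := by
  obtain ⟨L, hL, h⟩ := exists_dependsOn_heights_cast k x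
  refine (variance_comp_le hB hind hp0 hp1 hp h).trans ?_
  rw [mul_comm]
  gcongr
  have hle := fun ω => sum_sq_heights_update_sub_le (fun i => B i ω) k x L hL
  refine (integral_mono_of_nonneg (Eventually.of_forall fun ω => ?_) (integrable_const (k : ℝ))
    (Eventually.of_forall hle)).trans ?_
  · refine Finset.sum_nonneg fun i _ => ?_
    split_ifs <;> positivity
  · simp

/-- This serves to keep the means in a compact interval when passing to the limit. -/
theorem integral_heights_mem_Icc (hB : ∀ i, Measurable (B i))
    (hp : ∀ i, μ.real {ω | B i ω = true} = p) (k : ℕ) (x : Site d) :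
    ∫ ω, (heights (fun i => B i ω) k x : ℝ) ∂μ ∈ Icc 0 (k * p) := by
  have hi : ∀ i : ℕ, ∫ ω, (if B (x, i) ω then (1 : ℝ) else 0) ∂μ = p := fun i => by
    rw [← hp (x, i)]
    refine Eq.trans ?_ (integral_indicator_one (hB (x, i) (measurableSet_singleton true)))
    congr 1
    ext ω
    simp [indicator]
  have hint : ∀ i : ℕ, Integrable (fun ω => if B (x, i) ω then (1 : ℝ) else 0) μ := fun i =>
    Integrable.of_bound (Measurable.ite (hB (x, i) (measurableSet_singleton true))
      measurable_const measurable_const).aestronglyMeasurable 1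
      (Eventually.of_forall fun ω => by split_ifs <;> simp)
  constructor
  · exact integral_nonneg fun ω => Int.cast_nonneg (heights_nonneg _ _ _)
  · calc ∫ ω, (heights (fun i => B i ω) k x : ℝ) ∂μ
        ≤ ∫ ω, ∑ i ∈ Finset.range k, (if B (x, i) ω then (1 : ℝ) else 0) ∂μ := by
          refine integral_mono_of_nonneg
            (Eventually.of_forall fun ω => Int.cast_nonneg (heights_nonneg _ _ _))
            (integrable_finsetSum _ fun i _ => hint i) (Eventually.of_forall fun ω => ?_)
          dsimp only
          exact_mod_cast heights_le_sum (fun i => B i ω) k x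
      _ = k * p := by
          rw [integral_finsetSum _ fun i _ => hint i]
          simp [hi]

end Variance

theorem mainTheorem1 (d : ℕ) {Ω : Type*} [MeasurableSpace Ω] (μ : Measure Ω)
    [IsProbabilityMeasure μ] (U : Site d → Ω → Set ℝ≥0) (hU : ArePoissonClocks U μ) :
    (∀ᵐ ω ∂μ, ∃! f : ℝ≥0 → Site d → ℤ, IsRSOS (fun x => U x ω) 0 f) ∧
      ∀ RSOS : Ω → ℝ≥0 → Site d → ℤ,
        (∀ᵐ ω ∂μ, IsRSOS (fun x => U x ω) 0 (RSOS ω)) →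
        ∀ (t : ℝ≥0) (x : Site d),
          MemLp (fun ω => (RSOS ω t x : ℝ)) 2 μ ∧
            Var[fun ω => (RSOS ω t x : ℝ); μ] ≤ (t : ℝ) := by
  refine ⟨hU.ae_isGoodClocks.mono fun ω h => h.existsUnique_isRSOS, fun RSOS hR t x => ?_⟩
  have hB := fun n : ℕ => hU.measurable_gridBits (t / ((n + 1 : ℕ) : ℝ≥0))
  have hp := fun n : ℕ => hU.measureReal_gridBits (t / ((n + 1 : ℕ) : ℝ≥0))
  -- Mean and variance share the bound `(n + 1) * (1 - exp (-t / (n + 1))) ≤ t`. Measurability of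
  -- the height comes from the almost sure limit.
  refine memLp_two_and_variance_le_of_tendsto (C := t)
    (X := fun n ω => heights (gridBits (fun x => U x ω) (t / ((n + 1 : ℕ) : ℝ≥0))) (n + 1) x)
    (fun n => ?_) (fun n => ?_) (fun n => ?_) ?_
  · obtain ⟨L, -, h⟩ := exists_dependsOn_heights_cast (n + 1) x
    exact h.memLp_comp (hB n) 2
  · exact Icc_subset_Icc_right (mul_one_sub_exp_neg_div_le t n)
      (integral_heights_mem_Icc (hB n) (hp n) (n + 1) x)
  · exact (variance_heights_le (hB n) (hU.iIndepFun_gridBits _) (one_sub_exp_neg_nonneg _)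
      (sub_le_self _ (Real.exp_pos _).le) (hp n) (n + 1) x).trans (mul_one_sub_exp_neg_div_le t n)
  · filter_upwards [hU.ae_isGoodClocks, hR] with ω hω hRω
    -- For `t = 0` the mesh vanishes and convergence does not apply, but all slots are empty and no
    -- height moves.
    rcases eq_zero_or_pos t with rfl | ht
    · have h0 : ∀ n : ℕ, heights (gridBits (fun x => U x ω) (0 / ((n + 1 : ℕ) : ℝ≥0))) (n + 1) x =
          RSOS ω 0 x := fun n => by
        rw [hRω.init, heights_gridBits_eq (Nat.zero_le _)
          (fun τ hτ h1 h2 => by simp only [zero_div, mul_zero] at h1 h2; exact h1.not_ge h2)]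
        rfl
      simp only [h0]
      exact tendsto_const_nhds
    · exact tendsto_const_nhds.congr' ((hRω.eventually_eq_heights_div hω ht x).mono
        fun n hn => by rw [hn])
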